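/- Let $\mathcal W=W(2,2)$ be the complex Lie algebra with basis $\{L_n,W_n,z\mid n\in\mathbb Z\}$ and brackets $[L_n,L_m]=(m-n)L_{m+n}+\frac{n^3-n}{12}\delta_{m+n,0}z$, $[L_n,W_m]=(m-n)W_{m+n}+\frac{n^3-n}{12}\delta_{m+n,0}z$, $[W_n,W_m]=[z,W_m]=[z,L_m]=0$. Let $\mathcal W_+$ be the subalgebra spanned by the $L_n,W_n$ with $n>0$, and let $\varphi:\mathcal W_+\to\mathbb C$ be a Lie algebra homomorphism that is non-singular, i.e. $\varphi(L_i)\varphi(W_i)\ne 0$ for $i=1,2$; extend $\varphi$ to an algebra homomorphism $\mathcal U(\mathcal W_+)\to\mathbb C$. Let $V$ be a Whittaker module of type $\varphi$ with cyclic Whittaker vector $w$, i.e. $V$ is a $\mathcal W$-module generated by $w$, and $xw=\varphi(x)w$ for all $x\in\mathcal W_+$. Let $S(z)=\mathbb C[z]$ be the algebra of polynomials in $z$, acting on $V$ through $\mathcal U(\mathcal W)$, and suppose that $\mathrm{Ann}_{S(z)}(w)=(p(z))$ for a monic polynomial $p(z)$. Then $$\mathrm{Ann}_{\mathcal U(\mathcal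 W)}(w)=\mathcal U(\mathcal W)\,p(z)+\sum_{\lambda,\mu\in\mathcal P_+}\mathcal U(\mathcal W)\bigl(L_\lambda W_\mu-\varphi(L_\lambda W_\mu)\bigr),$$ where $\mathcal P_+$ is the set of positive partitions, i.e. nonempty finite sequences $\lambda=(\lambda_1\le\dots\le\lambda_r)$ of positive integers, $L_\lambda=L_{\lambda_1}\cdots L_{\lambda_r}$ and $W_\mu=W_{\mu_1}\cdots W_{\mu_s}$. -/

import Mathlib

open Polynomial

noncomputable section

namespace W22

/-- Labels of the basis `{L_n, W_n, z | n ∈ ℤ}`. -/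
inductive Gen : Type
  | L : ℤ → Gen
  | W : ℤ → Gen
  | z : Gen

/-- The underlying space of the Lie algebra `W(2,2)`: the complex vector space with basis
`{L_n, W_n, z | n ∈ ℤ}`. -/
def Alg : Type := Gen →₀ ℂ

instance : AddCommGroup Alg := inferInstanceAs (AddCommGroup (Gen →₀ ℂ))

instance : Module ℂ Alg := inferInstanceAs (Module ℂ (Gen →₀ ℂ))

/-- The basis vector with a given label. -/
def gen (a : Gen) : Alg := Finsupp.single a (1 : ℂ)

/-- The element `L_n`. -/
abbrev L (n : ℤ) : Alg := gen (Gen.L n)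

/-- The element `W_n`. -/
abbrev W (n : ℤ) : Alg := gen (Gen.W n)

/-- The central element `z`. -/
abbrev z : Alg := gen Gen.z

/-- The coefficient `(n³ - n)/12 · δ_{m+n,0}`. -/
def cocycle (n m : ℤ) : ℂ := if m + n = 0 then ((n : ℂ) ^ 3 - n) / 12 else 0

/-- The brackets of the basis vectors. -/
def genBracket : Gen → Gen → Alg
  | .L n, .L m => ((m : ℂ) - n) • L (m + n) + cocycle n m • z
  | .L n, .W m => ((m : ℂ) - n) • W (m + n) + cocycle n m • z
  | .W m, .L n => -(((m : ℂ) - n) • W (m + n) + cocycle n m • z)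
  | .W _, .W _ => 0
  | .z, _ => 0
  | _, .z => 0

/-- The bilinear extension of the brackets of the basis vectors. -/
def bracketHom : Alg →ₗ[ℂ] Alg →ₗ[ℂ] Alg :=
  Finsupp.linearCombination ℂ fun a : Gen =>
    (Finsupp.linearCombination ℂ fun b : Gen => genBracket a b : (Gen →₀ ℂ) →ₗ[ℂ] Alg)

lemma bracketHom_gen (a b : Gen) : bracketHom (gen a) (gen b) = genBracket a b := by
  have h1 : bracketHom (gen a) =
      (Finsupp.linearCombination ℂ fun b : Gen => genBracket a b : (Gen →₀ ℂ) →ₗ[ℂ] Alg) :=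
    (Finsupp.linearCombination_single ℂ (1 : ℂ) a).trans (one_smul ℂ _)
  rw [h1]
  exact (Finsupp.linearCombination_single ℂ (1 : ℂ) b).trans (one_smul ℂ _)

lemma alg_induction {P : Alg → Prop} (x : Alg) (h0 : P 0) (hadd : ∀ x y, P x → P y → P (x + y))
    (hsmul : ∀ (c : ℂ) (x), P x → P (c • x)) (hgen : ∀ a, P (gen a)) : P x := by
  refine Finsupp.induction_linear (motive := P) x h0 (fun f g hf hg => hadd f g hf hg) ?_
  intro a c
  have : (Finsupp.single a c : Gen →₀ ℂ) = c • (Finsupp.single a (1 : ℂ) : Gen →₀ ℂ) := by simp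
  rw [this]
  exact hsmul c (gen a) (hgen a)

lemma cocycle_symm (n m : ℤ) : cocycle m n = -cocycle n m := by
  unfold cocycle
  by_cases h : m + n = 0
  · obtain rfl : m = -n := by omega
    simp
    ring
  · have h' : ¬ n + m = 0 := by omega
    simp [h, h']

lemma bracketHom_skew (x y : Alg) : bracketHom y x = -bracketHom x y := by
  induction x using alg_induction with
  | h0 => simp
  | hadd x x' hx hx' => simp only [map_add, LinearMap.add_apply, hx, hx']; abel
  | hsmul c x hx => simp [hx]
  | hgen a =>
    induction y using alg_induction with
    | h0 => simp
    | hadd x x' hx hx' => simp only [map_add, LinearMap.add_apply, hx, hx']; abel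
    | hsmul c x hx => simp [hx]
    | hgen b =>
      rw [bracketHom_gen, bracketHom_gen]
      rcases a with n | n | _ <;> rcases b with m | m | _ <;> simp [genBracket]
      rw [cocycle_symm n m, add_comm n m, ← sub_eq_zero]
      module

lemma bracketHom_jacobi_gen (a b c : Gen) :
    bracketHom (gen a) (bracketHom (gen b) (gen c)) =
      bracketHom (bracketHom (gen a) (gen b)) (gen c) +
        bracketHom (gen b) (bracketHom (gen a) (gen c)) := by
  have key : ∀ i j k : ℤ, ((k : ℂ) - j) * cocycle i (k + j) =
      ((j : ℂ) - i) * cocycle (j + i) k + ((k : ℂ) - i) * cocycle j (k + i) := by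
    intro i j k
    unfold cocycle
    by_cases h : i + j + k = 0
    · have h1 : k + j + i = 0 := by omega
      have h2 : k + (j + i) = 0 := by omega
      have h3 : k + i + j = 0 := by omega
      obtain rfl : k = -i - j := by omega
      simp only [h1, h2, h3, if_true]
      push_cast
      ring
    · have h1 : ¬ k + j + i = 0 := by omega
      have h2 : ¬ k + (j + i) = 0 := by omega
      have h3 : ¬ k + i + j = 0 := by omega
      simp [h1, h2, h3]
  rcases a with i | i | _ <;> rcases b with j | j | _ <;> rcases c with k | k | _ <;>
    simp only [bracketHom_gen, genBracket, map_add, map_smul, map_neg, map_zero,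
      LinearMap.add_apply, LinearMap.smul_apply, LinearMap.neg_apply, LinearMap.zero_apply,
      smul_zero, add_zero, neg_zero]
  · rw [show k + (j + i) = k + j + i by ring, show k + i + j = k + j + i by ring]
    have h := congrArg (fun t : ℂ => t • z) (key i j k)
    simp only [add_smul, mul_smul] at h
    rw [smul_add, h]
    push_cast
    module
  · rw [show k + (j + i) = k + j + i by ring, show k + i + j = k + j + i by ring]
    have h := congrArg (fun t : ℂ => t • z) (key i j k)
    simp only [add_smul, mul_smul] at h
    rw [smul_add, h]
    push_cast
    module
  · rw [show j + (k + i) = j + k + i by ring, show j + i + k = j + k + i by ring,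
      add_comm j k, cocycle_symm (j + i) k, cocycle_symm j (k + i)]
    have h := congrArg (fun t : ℂ => t • z) (key i j k)
    simp only [add_smul, mul_smul] at h
    have h' : ((j : ℂ) - k) • cocycle i (k + j) • z = -(((k : ℂ) - j) • cocycle i (k + j) • z) := by
      module
    rw [smul_add, h', h]
    push_cast
    module
  · rw [show i + (k + j) = i + j + k by ring, show i + k + j = i + j + k by ring,
      cocycle_symm i (k + j), cocycle_symm (i + j) k, add_comm i j, add_comm i k]
    have h := congrArg (fun t : ℂ => t • z) (key i j k)
    simp only [add_smul, mul_smul] at h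
    rw [neg_smul, smul_neg, smul_add, smul_neg, h]
    push_cast
    module

lemma bracketHom_jacobi (x y t : Alg) :
    bracketHom x (bracketHom y t) =
      bracketHom (bracketHom x y) t + bracketHom y (bracketHom x t) := by
  induction x using alg_induction with
  | h0 => simp
  | hadd x x' hx hx' => simp only [map_add, LinearMap.add_apply, hx, hx']; abel
  | hsmul c x hx => simp [hx]
  | hgen a =>
    induction y using alg_induction with
    | h0 => simp
    | hadd x x' hx hx' => simp only [map_add, LinearMap.add_apply, hx, hx']; abel
    | hsmul c x hx => simp [hx]
    | hgen b =>
      induction t using alg_induction with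
      | h0 => simp
      | hadd x x' hx hx' => simp only [map_add, hx, hx']; abel
      | hsmul c x hx => simp [hx]
      | hgen c => exact bracketHom_jacobi_gen a b c

instance : LieRing Alg where
  bracket x y := bracketHom x y
  add_lie x y t := by
    change bracketHom (x + y) t = bracketHom x t + bracketHom y t
    simp
  lie_add x y t := (bracketHom x).map_add y t
  lie_self x := by
    have h : bracketHom x x + bracketHom x x = 0 := eq_neg_iff_add_eq_zero.mp (bracketHom_skew x x)
    have h2 : (2 : ℂ) • bracketHom x x = 0 := by rw [two_smul]; exact h
    exact (smul_eq_zero.mp h2).resolve_left two_ne_zero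
  leibniz_lie x y t := bracketHom_jacobi x y t

instance : LieAlgebra ℂ Alg where
  lie_smul c x y := (bracketHom x).map_smul c y

lemma lie_gen (a b : Gen) : ⁅gen a, gen b⁆ = genBracket a b := bracketHom_gen a b

/-! Positive part and characters. -/

/-- The subalgebra `𝒲₊`, spanned by the `L_n` and `W_n` with `n > 0`. -/
def Plus : LieSubalgebra ℂ Alg where
  __ := Submodule.span ℂ {x : Alg | ∃ n : ℤ, 0 < n ∧ (x = L n ∨ x = W n)}
  lie_mem' {x y} hx hy := by
    change x ∈ Submodule.span ℂ _ at hx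
    change y ∈ Submodule.span ℂ _ at hy
    change ⁅x, y⁆ ∈ Submodule.span ℂ _
    have hL : ∀ n : ℤ, 0 < n →
        L n ∈ Submodule.span ℂ {x : Alg | ∃ n : ℤ, 0 < n ∧ (x = L n ∨ x = W n)} :=
      fun n hn => Submodule.subset_span ⟨n, hn, Or.inl rfl⟩
    have hW : ∀ n : ℤ, 0 < n →
        W n ∈ Submodule.span ℂ {x : Alg | ∃ n : ℤ, 0 < n ∧ (x = L n ∨ x = W n)} :=
      fun n hn => Submodule.subset_span ⟨n, hn, Or.inr rfl⟩
    have hc : ∀ n m : ℤ, 0 < n → 0 < m → cocycle n m = 0 := by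
      intro n m hn hm
      have : ¬ m + n = 0 := by omega
      simp [cocycle, this]
    induction hx using Submodule.span_induction with
    | zero => simp
    | add a b _ _ ha hb => rw [add_lie]; exact add_mem ha hb
    | smul c a _ ha => rw [smul_lie]; exact Submodule.smul_mem _ c ha
    | mem a ha =>
      induction hy using Submodule.span_induction with
      | zero => simp
      | add a b _ _ ha hb => rw [lie_add]; exact add_mem ha hb
      | smul c a _ ha => rw [lie_smul]; exact Submodule.smul_mem _ c ha
      | mem b hb =>
        obtain ⟨n, hn, rfl | rfl⟩ := ha <;> obtain ⟨m, hm, rfl | rfl⟩ := hb <;>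
          simp only [L, W, lie_gen, genBracket, hc n m hn hm, hc m n hm hn, zero_smul, add_zero]
        · exact Submodule.smul_mem _ _ (hL _ (by omega))
        · exact Submodule.smul_mem _ _ (hW _ (by omega))
        · exact neg_mem (Submodule.smul_mem _ _ (hW _ (by omega)))
        · exact zero_mem _

/-- `L_n` as an element of `𝒲₊`, for `n > 0`. -/
def LPlus (n : ℕ+) : Plus :=
  ⟨L n, Submodule.subset_span ⟨n, by exact_mod_cast n.pos, Or.inl rfl⟩⟩

/-- `W_n` as an element of `𝒲₊`, for `n > 0`. -/
def WPlus (n : ℕ+) : Plus :=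
  ⟨W n, Submodule.subset_span ⟨n, by exact_mod_cast n.pos, Or.inr rfl⟩⟩

/-- The universal enveloping algebra `𝒰(𝒲)`. -/
abbrev U : Type := UniversalEnvelopingAlgebra ℂ Alg

/-- The universal enveloping algebra `𝒰(𝒲₊)`. -/
abbrev UPlus : Type := UniversalEnvelopingAlgebra ℂ Plus

attribute [local instance 100] LieRing.ofAssociativeRing

/-- Lie algebra homomorphisms `φ : 𝒲₊ → ℂ`. -/
abbrev Character : Type := Plus →ₗ⁅ℂ⁆ ℂ

/-- `φ` is non-singular if `φ(L_i) φ(W_i) ≠ 0` for `i = 1, 2`. -/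
def Character.NonSingular (φ : Character) : Prop :=
  φ (LPlus 1) * φ (WPlus 1) ≠ 0 ∧ φ (LPlus 2) * φ (WPlus 2) ≠ 0

/-- The extension of `φ` to an algebra homomorphism `𝒰(𝒲₊) → ℂ`. -/
def Character.ext (φ : Character) : UPlus →ₐ[ℂ] ℂ := UniversalEnvelopingAlgebra.lift ℂ φ

/-- The algebra homomorphism `𝒰(𝒲₊) → 𝒰(𝒲)` induced by the inclusion `𝒲₊ ⊆ 𝒲`. -/
def incl : UPlus →ₐ[ℂ] U :=
  UniversalEnvelopingAlgebra.lift ℂ ((UniversalEnvelopingAlgebra.ι ℂ).comp Plus.incl)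

/-- A positive partition: a nonempty non-decreasing finite sequence of positive integers. -/
structure PosPartition : Type where
  /-- The parts, in non-decreasing order. -/
  parts : List ℕ+
  sorted : parts.Pairwise (· ≤ ·)
  nonempty : parts ≠ []

/-- `L_λ = L_{λ_1} L_{λ_2} ⋯ L_{λ_r}`. -/
def PosPartition.L (p : PosPartition) : UPlus :=
  (p.parts.map fun n => UniversalEnvelopingAlgebra.ι ℂ (LPlus n)).prod

/-- `W_λ = W_{λ_1} W_{λ_2} ⋯ W_{λ_r}`. -/
def PosPartition.W (p : PosPartition) : UPlus :=
  (p.parts.map fun n => UniversalEnvelopingAlgebra.ι ℂ (WPlus n)).prod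

/-- The element `p(z)` of `𝒰(𝒲)` for a polynomial `p`; this identifies `S(z)` with `ℂ[X]`. -/
def polyZ (p : ℂ[X]) : U := aeval (UniversalEnvelopingAlgebra.ι ℂ z) p

section Module

variable {V : Type*} [AddCommGroup V] [Module ℂ V] [LieRingModule Alg V] [LieModule ℂ Alg V]

variable (V) in
/-- The action of `𝒰(𝒲)` on a `𝒲`-module. -/
def act : U →ₐ[ℂ] Module.End ℂ V :=
  UniversalEnvelopingAlgebra.lift ℂ (LieModule.toEnd ℂ Alg V)

/-- `w` is a Whittaker vector of type `φ`. -/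
def IsWhittakerVector (φ : Character) (w : V) : Prop :=
  ∀ x : Plus, ⁅(x : Alg), w⁆ = φ x • w

/-- `V` is a Whittaker module of type `φ` with cyclic Whittaker vector `w`. -/
structure IsCyclicWhittakerVector (φ : Character) (w : V) : Prop where
  nonSingular : φ.NonSingular
  isWhittaker : IsWhittakerVector φ w
  generates : LieSubmodule.lieSpan ℂ Alg {w} = ⊤

/-- The left ideal `Ann_{𝒰(𝒲)}(w)`. -/
def annU (w : V) : Ideal U where
  carrier := {u | act V u w = 0}
  add_mem' {a b} ha hb := by
    change act V a w = 0 at ha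
    change act V b w = 0 at hb
    change act V (a + b) w = 0
    rw [map_add, LinearMap.add_apply, ha, hb, add_zero]
  zero_mem' := by
    change act V 0 w = 0
    rw [map_zero, LinearMap.zero_apply]
  smul_mem' c a ha := by
    change act V a w = 0 at ha
    change act V (c * a) w = 0
    rw [map_mul, Module.End.mul_apply, ha, map_zero]

/-- The ideal `Ann_{S(z)}(w)` of `S(z) = ℂ[X]`. -/
def annS (w : V) : Ideal ℂ[X] where
  carrier := {p | act V (polyZ p) w = 0}
  add_mem' {a b} ha hb := by
    change act V (polyZ a) w = 0 at ha
    change act V (polyZ b) w = 0 at hb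
    change act V (polyZ (a + b)) w = 0
    rw [polyZ, map_add, map_add, LinearMap.add_apply]
    exact (congrArg₂ (· + ·) ha hb).trans (add_zero 0)
  zero_mem' := by
    change act V (polyZ 0) w = 0
    rw [polyZ, map_zero, map_zero, LinearMap.zero_apply]
  smul_mem' c a ha := by
    change act V (polyZ a) w = 0 at ha
    change act V (polyZ (c * a)) w = 0
    rw [polyZ, map_mul, map_mul, Module.End.mul_apply]
    exact (congrArg _ ha).trans (map_zero _)

end Module

end W22

end

noncomputable section

namespace W22

attribute [local instance 100] LieRing.ofAssociativeRing

/-! Let `J` be the left ideal on the right-hand side. That `J` annihilates `w` is immediate. For the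
converse, compare `w` with the class `v` of `1` in `U ⧸ J`. Non-singularity makes `v` a Whittaker
vector of type `φ` (`isWhittakerFor_of_partitions`), so `v ↦ w` gives a map of `𝒲`-modules, and it
remains to show that this map is injective (`eq_zero_of_map_eq_zero`).

Injectivity needs no PBW basis. Modulo shorter words, a vector of a Whittaker module is a polynomial
in `L_0, L_{-1}, …` with coefficients in the commutative algebra `WZ`. The element `W_{k+2} -
φ(W_{k+2})` kills `w`. On polynomials in `L_0, …, L_{-k}` it acts on leading terms as `-(2k+2)
φ(W_2) ∂/∂L_{-k}`, because `W_n w = 0` for `n ≥ 3`. Differentiating down to constants shows that the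
leading term is unique modulo the annihilator of `w` in `WZ`. That annihilator is treated in the
same way: it is stable under `[L_{k+2}, ·]`, which acts on polynomials in `W_0, …, W_{-k}` as a
nonzero multiple of `∂/∂W_{-k}` modulo the annihilator. Everything is thus reduced to polynomials in
`z`, where the annihilator of `w` is `(p)` and `p(z) ∈ J`. -/

/-! ### Descent of coefficients by differentiation. -/

/-- If an additive subgroup of a polynomial ring is stable under differentiation with respect to
the largest variable, then the coefficients of its elements lie in any ideal `I` that contains its
constants and whose monomials it contains. -/
lemma coeff_mem_of_pderiv_stable {R : Type*} [CommRing R] [Algebra ℂ R] (I : Ideal R)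
    (K : AddSubgroup (MvPolynomial ℕ R)) (h0 : ∀ a, MvPolynomial.C a ∈ K → a ∈ I)
    (h1 : ∀ a ∈ I, ∀ m, MvPolynomial.monomial m a ∈ K)
    (h2 : ∀ k, ∀ P ∈ K, (∀ m ∈ P.support, ∀ j ∈ m.support, j ≤ k) →
      MvPolynomial.pderiv k P ∈ K)
    {P : MvPolynomial ℕ R} (hP : P ∈ K) (m : ℕ →₀ ℕ) : P.coeff m ∈ I := by
  -- Outer induction on a bound `n` for the degree, inner induction on a strict bound `k` for the
  -- variables.
  have main : ∀ n k : ℕ, ∀ P ∈ K, (∀ m ∈ P.support, m.degree ≤ n) →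
      (∀ m ∈ P.support, ∀ j ∈ m.support, j < k) → ∀ m, P.coeff m ∈ I := by
    intro n
    induction n with
    | zero =>
      intro k P hP hd _ m
      by_cases hm : m ∈ P.support
      · have hC : P = MvPolynomial.C (P.coeff 0) := by
          ext m'
          rw [MvPolynomial.coeff_C]
          split_ifs with h
          · rw [← h]
          · by_contra h'
            exact h ((Finsupp.degree_eq_zero_iff m').1
              (Nat.le_zero.1 (hd m' (MvPolynomial.mem_support_iff.2 h')))).symm
        have hm0 : m = 0 := (Finsupp.degree_eq_zero_iff m).1 (Nat.le_zero.1 (hd m hm))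
        rw [hm0]
        exact h0 _ (hC ▸ hP)
      · rw [MvPolynomial.notMem_support_iff.1 hm]
        exact I.zero_mem
    | succ n ihn =>
      intro k
      induction k with
      | zero =>
        intro P hP _ hk m
        by_cases hm : m ∈ P.support
        · have hz : ∀ m' ∈ P.support, m' = 0 := fun m' hm' =>
            Finsupp.support_eq_empty.1 (Finset.eq_empty_of_forall_notMem fun j hj =>
              absurd (hk m' hm' j hj) (Nat.not_lt_zero j))
          have hC : P = MvPolynomial.C (P.coeff 0) := by
            ext m'
            rw [MvPolynomial.coeff_C]
            split_ifs with h
            · rw [← h]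
            · by_contra h'
              exact h (hz m' (MvPolynomial.mem_support_iff.2 h')).symm
          rw [hz m hm]
          exact h0 _ (hC ▸ hP)
        · rw [MvPolynomial.notMem_support_iff.1 hm]
          exact I.zero_mem
      | succ k ihk =>
        intro P hP hd hk
        -- Coefficients of monomials that involve the largest variable reappear in `pderiv k P`, of
        -- smaller degree, multiplied by the exponent, which is invertible over `ℂ`.
        have hpos : ∀ m : ℕ →₀ ℕ, m k ≠ 0 → P.coeff m ∈ I := by
          intro m hm
          have hmk : m - Finsupp.single k 1 + Finsupp.single k 1 = m := by
            ext j
            by_cases hj : k = j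
            · subst hj
              simp
              omega
            · simp [Finsupp.single_eq_of_ne (Ne.symm hj)]
          have key := ihn (k + 1) (MvPolynomial.pderiv k P)
            (h2 k P hP fun m hm j hj => Nat.lt_succ_iff.1 (hk m hm j hj)) ?_ ?_
            (m - Finsupp.single k 1)
          · rw [MvPolynomial.coeff_pderiv, hmk] at key
            have hne : ((m k : ℕ) : ℂ) ≠ 0 := Nat.cast_ne_zero.2 hm
            have h3 := I.mul_mem_left (algebraMap ℂ R ((m k : ℂ)⁻¹)) key
            have h4 : (((m - (Finsupp.single k 1 : ℕ →₀ ℕ)) k : ℕ) : R) + 1 =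
                algebraMap ℂ R (m k : ℂ) := by
              rw [map_natCast, ← Nat.cast_succ]
              congr 1
              simp
              omega
            rw [h4, mul_left_comm, ← map_mul, inv_mul_cancel₀ hne, map_one, mul_one] at h3
            exact h3
          · intro m' hm'
            rw [MvPolynomial.mem_support_iff, MvPolynomial.coeff_pderiv] at hm'
            have := hd _ (MvPolynomial.mem_support_iff.2 (left_ne_zero_of_mul hm'))
            rw [map_add, Finsupp.degree_single] at this
            omega
          · intro m' hm' j hj
            rw [MvPolynomial.mem_support_iff, MvPolynomial.coeff_pderiv] at hm'
            refine hk _ (MvPolynomial.mem_support_iff.2 (left_ne_zero_of_mul hm')) j ?_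
            rw [Finsupp.mem_support_iff] at hj ⊢
            rw [Finsupp.add_apply]
            omega
        intro m
        by_cases hm : m k = 0
        -- `Q` collects the monomials already settled; `P - Q` is still in `K` and has one variable
        -- fewer.
        · set Q := ∑ m ∈ P.support.filter fun m => m k ≠ 0,
            MvPolynomial.monomial m (P.coeff m) with hQ
          have hQK : Q ∈ K := sum_mem fun m hm => h1 _ (hpos m (Finset.mem_filter.1 hm).2) m
          have hco : ∀ m, Q.coeff m = if m k ≠ 0 then P.coeff m else 0 := by
            intro m
            rw [hQ, MvPolynomial.coeff_sum]
            simp only [MvPolynomial.coeff_monomial, Finset.sum_ite_eq', Finset.mem_filter,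
              MvPolynomial.mem_support_iff]
            by_cases h : P.coeff m = 0 <;> simp [h]
          have hco' : ∀ m, (P - Q).coeff m = if m k = 0 then P.coeff m else 0 := by
            intro m
            rw [MvPolynomial.coeff_sub, hco]
            by_cases h : m k = 0 <;> simp [h]
          have := ihk (P - Q) (sub_mem hP hQK) ?_ ?_ m
          · rwa [hco', if_pos hm] at this
          · intro m hm
            rw [MvPolynomial.mem_support_iff, hco'] at hm
            exact hd m (MvPolynomial.mem_support_iff.2 fun h => hm (by simp [h]))
          · intro m hm j hj
            rw [MvPolynomial.mem_support_iff, hco'] at hm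
            have h5 := hk m (MvPolynomial.mem_support_iff.2 fun h => hm (by simp [h])) j hj
            have h6 : j ≠ k := by
              rintro rfl
              exact hm (if_neg (Finsupp.mem_support_iff.1 hj))
            omega
        · exact hpos m hm
  refine main (P.support.sup fun m => m.degree) (P.support.sup (fun m => m.support.sup id) + 1) P hP
    (fun m hm => Finset.le_sup (f := fun m : ℕ →₀ ℕ => m.degree) hm) (fun m hm j hj => ?_) m
  have h7 : j ≤ m.support.sup id := Finset.le_sup (f := id) hj
  have h8 := Finset.le_sup (f := fun m : ℕ →₀ ℕ => m.support.sup id) hm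
  exact Nat.lt_succ_of_le (h7.trans h8)

/-! ### Creation operators, the length filtration and symbols. -/

/-- A module `V` over a commutative ring `A` with a vector `vac` and creation operators `op j` that
satisfy a Leibniz rule over `A` and commute up to terms of lower order. -/
structure CreationSystem (A V : Type*) [CommRing A] [AddCommGroup V] [Module A V] where
  op : ℕ → V →+ V
  der : ℕ → A → A
  op_smul : ∀ j a v, op j (a • v) = a • op j v + der j a • v
  op_comm : ∀ i j, ∃ c a : A, ∀ v, op i (op j v) = op j (op i v) + c • op (i + j) v + a • v
  vac : V

namespace CreationSystem

variable {A V : Type*} [CommRing A] [AddCommGroup V] [Module A V] (S : CreationSystem A V)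

/-- The vector obtained from `vac` by the word `l` of creation operators. -/
def vec (l : List ℕ) : V := l.foldr (fun j v => S.op j v) S.vac

@[simp] lemma vec_nil : S.vec [] = S.vac := rfl

@[simp] lemma vec_cons (j : ℕ) (l : List ℕ) : S.vec (j :: l) = S.op j (S.vec l) := rfl

/-- The filtration of `V` by the length of words of creation operators. -/
def fil (d : ℤ) : Submodule A V :=
  Submodule.span A {v | ∃ l : List ℕ, (l.length : ℤ) ≤ d ∧ v = S.vec l}

lemma vec_mem {l : List ℕ} {d : ℤ} (h : (l.length : ℤ) ≤ d) : S.vec l ∈ S.fil d :=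
  Submodule.subset_span ⟨l, h, rfl⟩

lemma fil_mono {d e : ℤ} (h : d ≤ e) : S.fil d ≤ S.fil e :=
  Submodule.span_mono fun _ ⟨l, hl, hv⟩ => ⟨l, hl.trans h, hv⟩

/-- With integer degrees the bounds `d - 1` and `d - 2` keep their meaning at the bottom of the
filtration, where they force a vector to vanish. -/
lemma fil_of_neg {d : ℤ} (h : d < 0) : S.fil d = ⊥ := by
  rw [fil, Submodule.span_eq_bot]
  rintro v ⟨l, hl, -⟩
  omega

lemma op_mem {d : ℤ} {v : V} (hv : v ∈ S.fil d) (j : ℕ) : S.op j v ∈ S.fil (d + 1) := by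
  induction hv using Submodule.span_induction with
  | zero => rw [map_zero]; exact zero_mem _
  | add x y _ _ hx hy => rw [map_add]; exact add_mem hx hy
  | smul a x hx h =>
    rw [S.op_smul]
    exact add_mem (Submodule.smul_mem _ _ h)
      (Submodule.smul_mem _ _ (S.fil_mono (by omega) hx))
  | mem x hx =>
    obtain ⟨l, hl, rfl⟩ := hx
    exact S.vec_mem (l := j :: l) (by simpa using hl)

/-- Swapping neighbours costs only shorter words by `op_comm`. Hence the arbitrary order that
`toList` picks in `ofPoly` is harmless. -/
lemma vec_perm {l l' : List ℕ} (h : l.Perm l') :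
    S.vec l - S.vec l' ∈ S.fil ((l.length : ℤ) - 1) := by
  induction h with
  | nil => simp
  | cons j _ ih =>
    rw [vec_cons, vec_cons, ← map_sub]
    exact S.fil_mono (by simp) (S.op_mem ih j)
  | swap i j l =>
    obtain ⟨c, a, h⟩ := S.op_comm j i
    simp only [vec_cons]
    rw [h, add_assoc, add_sub_cancel_left]
    exact add_mem (Submodule.smul_mem _ _ (S.vec_mem (l := (j + i) :: l) (by simp)))
      (Submodule.smul_mem _ _ (S.vec_mem (by simp)))
  | @trans l₁ l₂ l₃ h1 _ ih1 ih2 =>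
    rw [← sub_add_sub_cancel _ (S.vec l₂)]
    rw [← h1.length_eq] at ih2
    exact add_mem ih1 ih2

/-- Moving `a` to the right past an operator leaves a term with that operator removed, and at the
end `a` meets `vac`. -/
lemma ann_smul_mem {a : A} (ha : a • S.vac = 0) {d : ℤ} {v : V} (hv : v ∈ S.fil d) :
    a • v ∈ S.fil (d - 1) := by
  have hl : ∀ l : List ℕ, a • S.vec l ∈ S.fil ((l.length : ℤ) - 1) := by
    intro l
    induction l with
    | nil => simp [ha]
    | cons j l ih =>
      have h := S.op_smul j a (S.vec l)
      rw [vec_cons, eq_sub_of_add_eq h.symm]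
      exact sub_mem (S.fil_mono (by simp) (S.op_mem ih j))
        (Submodule.smul_mem _ _ (S.vec_mem (by simp)))
  induction hv using Submodule.span_induction with
  | zero => rw [smul_zero]; exact zero_mem _
  | add x y _ _ hx hy => rw [smul_add]; exact add_mem hx hy
  | smul b x _ hx => rw [smul_comm]; exact Submodule.smul_mem _ _ hx
  | mem x hx =>
    obtain ⟨l, hd, rfl⟩ := hx
    exact S.fil_mono (by omega) (hl l)

/-- An element `e` of `A` that annihilates `vac` and lowers the filtration: among the creation
operators with index at most `k` it annihilates exactly the one with index `k`. -/
structure IsLowering (k : ℕ) (e c : A) : Prop where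
  smul_vac : e • S.vac = 0
  der_lt : ∀ j < k, S.der j e • S.vac = 0
  der_self : (S.der k e + c) • S.vac = 0

/-- Moving `e` past `op j` produces `-der j e`. On `vac` this is `0` for `j < k` and `c` for `j =
k`, so by `ann_smul_mem` it may be replaced by that value at the cost of one more degree. Each
occurrence of `k` contributes one deletion, which is the product rule for `c ∂/∂x_k`. -/
lemma IsLowering.smul_vec {S : CreationSystem A V} {k : ℕ} {e c : A} (he : S.IsLowering k e c)
    {l : List ℕ} (hl : ∀ j ∈ l, j ≤ k) :
    e • S.vec l - (c * (l.count k : A)) • S.vec (l.erase k) ∈ S.fil ((l.length : ℤ) - 2) := by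
  induction l with
  | nil => simp [he.smul_vac]
  | cons j l ih =>
    have ih := ih fun i hi => hl i (List.mem_cons_of_mem j hi)
    have h := S.op_smul j e (S.vec l)
    rw [vec_cons, eq_sub_of_add_eq h.symm]
    have hop := S.op_mem ih j
    rw [map_sub, S.op_smul j (c * _)] at hop
    have hop' : S.op j (e • S.vec l) - (c * (l.count k : A)) • S.vec (j :: l.erase k) ∈
        S.fil ((l.length : ℤ) - 1) := by
      rw [← sub_sub] at hop
      have h1 : S.der j (c * (l.count k : A)) • S.vec (l.erase k) ∈ S.fil ((l.length : ℤ) - 1) := by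
        by_cases hk : k ∈ l
        · refine Submodule.smul_mem _ _ (S.vec_mem ?_)
          rw [List.length_erase_of_mem hk]
          have := List.length_pos_of_mem hk
          omega
        -- `der j` is not assumed additive; that `der j 0` acts as zero is read off from `op_smul`.
        · have h0 := S.op_smul j (c * (l.count k : A)) (S.vec (l.erase k))
          rw [List.count_eq_zero.2 hk] at h0 ⊢
          simp only [Nat.cast_zero, mul_zero, zero_smul, map_zero, zero_add] at h0 ⊢
          rw [← h0]
          exact zero_mem _
      have h2 := add_mem (S.fil_mono (by omega) hop) h1
      rwa [sub_add_cancel] at h2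
    have hlen : ((j :: l).length : ℤ) - 2 = l.length - 1 := by
      simp only [List.length_cons, Nat.cast_succ]; omega
    rw [hlen]
    rcases (hl j List.mem_cons_self).lt_or_eq with hj | rfl
    · rw [List.count_cons_of_ne hj.ne, List.erase_cons_tail (by simpa using hj.ne)]
      have h3 := S.ann_smul_mem (he.der_lt j hj) (S.vec_mem (l := l) le_rfl)
      have h4 := sub_mem hop' h3
      convert h4 using 1
      abel
    · rw [List.count_cons_self, List.erase_cons_head]
      have h3 := S.ann_smul_mem he.der_self (S.vec_mem (l := l) le_rfl)
      have h5 : (c * (l.count j : A)) • S.vec (j :: l.erase j) - (c * (l.count j : A)) • S.vec l ∈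
          S.fil ((l.length : ℤ) - 1) := by
        by_cases hk : j ∈ l
        · rw [← smul_sub]
          have h6 := S.vec_perm (List.perm_cons_erase hk).symm
          rw [(List.perm_cons_erase hk).symm.length_eq] at h6
          exact Submodule.smul_mem _ _ h6
        · simp [List.count_eq_zero.2 hk]
      have h4 := sub_mem (add_mem hop' h5) h3
      convert h4 using 1
      rw [add_smul]
      push_cast
      rw [mul_add, mul_one, add_smul]
      abel

/-- The linear map that sends a monomial to a word of creation operators applied to `vac`. -/
def ofPoly : MvPolynomial ℕ A →ₗ[A] V :=
  (MvPolynomial.basisMonomials ℕ A).constr A fun m => S.vec (Finsupp.toMultiset m).toList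

lemma ofPoly_monomial (m : ℕ →₀ ℕ) (a : A) :
    S.ofPoly (MvPolynomial.monomial m a) = a • S.vec (Finsupp.toMultiset m).toList := by
  have h : MvPolynomial.monomial m a = a • MvPolynomial.basisMonomials ℕ A m := by
    rw [MvPolynomial.coe_basisMonomials, MvPolynomial.smul_monomial, smul_eq_mul, mul_one]
  rw [h, map_smul, ofPoly, Module.Basis.constr_basis]

lemma length_toList_toMultiset (m : ℕ →₀ ℕ) : (Finsupp.toMultiset m).toList.length = m.degree := by
  rw [Multiset.length_toList, Finsupp.card_toMultiset]
  rfl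

lemma IsLowering.smul_ofPoly {S : CreationSystem A V} {k : ℕ} {e c : A} (he : S.IsLowering k e c)
    {d : ℕ} {P : MvPolynomial ℕ A} (hP : P.IsHomogeneous d)
    (hk : ∀ m ∈ P.support, ∀ j ∈ m.support, j ≤ k) :
    e • S.ofPoly P - c • S.ofPoly (MvPolynomial.pderiv k P) ∈ S.fil ((d : ℤ) - 2) := by
  conv =>
    enter [2]
    rw [P.as_sum]
  rw [map_sum, map_sum, map_sum, Finset.smul_sum, Finset.smul_sum, ← Finset.sum_sub_distrib]
  refine sum_mem fun m hm => ?_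
  have hd := not_imp_comm.1 hP.coeff_eq_zero (MvPolynomial.mem_support_iff.1 hm)
  rw [MvPolynomial.pderiv_monomial, ofPoly_monomial, ofPoly_monomial]
  set l := (Finsupp.toMultiset m).toList with hl
  have hmem : ∀ j ∈ l, j ≤ k := fun j hj => by
    rw [hl, Multiset.mem_toList, Finsupp.mem_toMultiset] at hj
    exact hk m hm j hj
  have hlen : l.length = d := by rw [hl, length_toList_toMultiset, hd]
  have hcount : l.count k = m k := by
    rw [← Multiset.coe_count, hl, Multiset.coe_toList, Finsupp.count_toMultiset]
  have h1 := Submodule.smul_mem _ (P.coeff m) (he.smul_vec hmem)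
  rw [hlen, hcount] at h1
  by_cases h0 : m k = 0
  · simp only [h0, Nat.cast_zero, mul_zero, zero_smul, smul_zero, sub_zero] at h1 ⊢
    rwa [smul_comm]
  · have hkl : k ∈ l := List.count_pos_iff.1 (by omega)
    have hperm : (l.erase k).Perm (Finsupp.toMultiset (m - Finsupp.single k 1)).toList := by
      rw [← Multiset.coe_eq_coe, Multiset.coe_toList, ← Multiset.coe_erase, hl, Multiset.coe_toList]
      ext j
      rw [Finsupp.count_toMultiset, Finsupp.tsub_apply]
      by_cases hj : j = k
      · subst hj
        rw [Multiset.count_erase_self, Finsupp.count_toMultiset, Finsupp.single_eq_same]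
      · rw [Multiset.count_erase_of_ne hj, Finsupp.count_toMultiset, Finsupp.single_eq_of_ne hj,
          Nat.sub_zero]
    have h2 := S.vec_perm hperm
    have hlen' : ((l.erase k).length : ℤ) - 1 = d - 2 := by
      rw [List.length_erase_of_mem hkl, hlen]
      have := List.length_pos_of_mem hkl
      omega
    rw [hlen'] at h2
    have h3 := add_mem h1 (Submodule.smul_mem _ (P.coeff m * (c * (m k : A))) h2)
    convert h3 using 1
    simp only [smul_sub, smul_smul]
    rw [mul_comm e, mul_left_comm c]
    abel

lemma homogeneousComponent_pderiv (k d : ℕ) (P : MvPolynomial ℕ A) :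
    MvPolynomial.homogeneousComponent d (MvPolynomial.pderiv k P) =
      MvPolynomial.pderiv k (MvPolynomial.homogeneousComponent (d + 1) P) := by
  ext m
  rw [MvPolynomial.coeff_homogeneousComponent, MvPolynomial.coeff_pderiv,
    MvPolynomial.coeff_pderiv, MvPolynomial.coeff_homogeneousComponent, map_add,
    Finsupp.degree_single]
  by_cases h : m.degree = d <;> simp [h]

lemma ofPoly_mem_of_coeff {d : ℕ} {P : MvPolynomial ℕ A} (hP : P.IsHomogeneous d)
    (h : ∀ m, P.coeff m • S.vac = 0) : S.ofPoly P ∈ S.fil ((d : ℤ) - 1) := by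
  rw [P.as_sum, map_sum]
  refine sum_mem fun m hm => ?_
  rw [ofPoly_monomial]
  refine S.ann_smul_mem (h m) (S.vec_mem ?_)
  rw [length_toList_toMultiset,
    not_imp_comm.1 hP.coeff_eq_zero (MvPolynomial.mem_support_iff.1 hm)]

lemma exists_ofPoly {d : ℕ} {x : V} (hx : x ∈ S.fil d) :
    ∃ P : MvPolynomial ℕ A, P.IsHomogeneous d ∧ x - S.ofPoly P ∈ S.fil ((d : ℤ) - 1) := by
  induction hx using Submodule.span_induction with
  | zero => exact ⟨0, MvPolynomial.isHomogeneous_zero _ _ _, by simp⟩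
  | add x y _ _ hx hy =>
    obtain ⟨P, hP, hx⟩ := hx
    obtain ⟨Q, hQ, hy⟩ := hy
    refine ⟨P + Q, hP.add hQ, ?_⟩
    rw [map_add, add_sub_add_comm]
    exact add_mem hx hy
  | smul a x _ hx =>
    obtain ⟨P, hP, hx⟩ := hx
    refine ⟨MvPolynomial.C a * P, hP.C_mul a, ?_⟩
    rw [MvPolynomial.C_mul', map_smul, ← smul_sub]
    exact Submodule.smul_mem _ _ hx
  | mem x hx =>
    obtain ⟨l, hl, rfl⟩ := hx
    rcases hl.lt_or_eq with hl | hl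
    · exact ⟨0, MvPolynomial.isHomogeneous_zero _ _ _, by
        rw [map_zero, sub_zero]; exact S.vec_mem (by omega)⟩
    · have hperm : l.Perm (Finsupp.toMultiset (Multiset.toFinsupp (l : Multiset ℕ))).toList := by
        rw [← Multiset.coe_eq_coe, Multiset.coe_toList, Multiset.toFinsupp_toMultiset]
      refine ⟨MvPolynomial.monomial (Multiset.toFinsupp (l : Multiset ℕ)) 1,
        MvPolynomial.isHomogeneous_monomial _ ?_, ?_⟩
      · rw [← length_toList_toMultiset, ← hperm.length_eq]
        exact_mod_cast hl
      · rw [ofPoly_monomial, one_smul, ← hl]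
        exact S.vec_perm hperm

/-- In the presence of lowering elements, the symbol of a vector is unique modulo the annihilator
of `vac`. -/
theorem coeff_smul_vac [Algebra ℂ A]
    (hS : ∀ k, ∃ (e : A) (c : ℂ), c ≠ 0 ∧ S.IsLowering k e (algebraMap ℂ A c))
    {d : ℕ} {P : MvPolynomial ℕ A} (hP : P.IsHomogeneous d) (h : S.ofPoly P ∈ S.fil ((d : ℤ) - 1))
    (m : ℕ →₀ ℕ) : P.coeff m • S.vac = 0 := by
  -- `K` consists of the polynomials all of whose homogeneous components have vanishing symbol. The
  -- ideal of coefficients is the annihilator of `vac`.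
  let K : AddSubgroup (MvPolynomial ℕ A) :=
    { carrier := {P | ∀ d : ℕ, S.ofPoly (MvPolynomial.homogeneousComponent d P) ∈
        S.fil ((d : ℤ) - 1)}
      zero_mem' := fun d => by simp
      add_mem' := fun {P Q} hP hQ d => by
        rw [map_add, map_add]
        exact add_mem (hP d) (hQ d)
      neg_mem' := fun {P} hP d => by
        rw [map_neg, map_neg]
        exact neg_mem (hP d) }
  have hhom : ∀ (d d' : ℕ) (P : MvPolynomial ℕ A), P.IsHomogeneous d →
      MvPolynomial.homogeneousComponent d' P = if d = d' then P else 0 := fun d d' P hP =>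
    (MvPolynomial.homogeneousComponent_of_mem hP).trans (by simp only [eq_comm])
  refine (Ideal.mem_torsionOf_iff S.vac _).1
    (coeff_mem_of_pderiv_stable (Ideal.torsionOf A V S.vac) K ?_ ?_ ?_ (P := P) ?_ m)
  · intro a ha
    have h0 := ha 0
    rw [hhom 0 0 _ (MvPolynomial.isHomogeneous_C _ _), if_pos rfl, S.fil_of_neg (by simp),
      MvPolynomial.C_apply, ofPoly_monomial] at h0
    simpa using h0
  · intro a ha m d
    rw [hhom m.degree d _ (MvPolynomial.isHomogeneous_monomial _ rfl)]
    split_ifs with hd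
    · rw [ofPoly_monomial]
      refine S.ann_smul_mem ((Ideal.mem_torsionOf_iff _ _).1 ha) (S.vec_mem ?_)
      rw [length_toList_toMultiset, hd]
    · rw [map_zero]
      exact zero_mem _
  · intro k P hP hk d
    obtain ⟨e, c, hc, he⟩ := hS k
    rw [homogeneousComponent_pderiv]
    have h1 := he.smul_ofPoly (MvPolynomial.homogeneousComponent_isHomogeneous (d + 1) P)
      fun m hm j hj => hk m (by
        rw [MvPolynomial.mem_support_iff, MvPolynomial.coeff_homogeneousComponent] at hm
        exact MvPolynomial.mem_support_iff.2 (ite_ne_right_iff.1 hm).2) j hj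
    -- `e` sends the component of degree `d + 1` into `fil (d - 1)`, and modulo `fil (d - 1)` the
    -- result is `c` times the vector of its derivative.
    have h2 := S.ann_smul_mem he.smul_vac (hP (d + 1))
    rw [show ((d + 1 : ℕ) : ℤ) - 1 - 1 = (d : ℤ) - 1 by push_cast; ring] at h2
    rw [show ((d + 1 : ℕ) : ℤ) - 2 = (d : ℤ) - 1 by push_cast; ring] at h1
    have h3 := Submodule.smul_mem _ (algebraMap ℂ A c⁻¹) (sub_mem h2 h1)
    rwa [sub_sub_cancel, smul_smul, ← map_mul, inv_mul_cancel₀ hc, map_one, one_smul] at h3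
  · intro d'
    rw [hhom d d' P hP]
    split_ifs with hd
    · rwa [← hd]
    · rw [map_zero]
      exact zero_mem _

/-- A morphism of modules with creation operators is injective on the vectors generated by the
vacuum if it is injective on the multiples of the vacuum. -/
theorem eq_zero_of_map_eq_zero [Algebra ℂ A] {M : Type*} [AddCommGroup M] [Module A M]
    (T : CreationSystem A M)
    (hS : ∀ k, ∃ (e : A) (c : ℂ), c ≠ 0 ∧ S.IsLowering k e (algebraMap ℂ A c))
    (f : M →ₗ[A] V) (hop : ∀ j x, f (T.op j x) = S.op j (f x)) (hvac : f T.vac = S.vac)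
    (hinj : ∀ a : A, a • S.vac = 0 → a • T.vac = 0) (d : ℕ) :
    ∀ x ∈ T.fil ((d : ℤ) - 1), f x = 0 → x = 0 := by
  have hvec : ∀ l, f (T.vec l) = S.vec l := by
    intro l
    induction l with
    | nil => exact hvac
    | cons j l ih => rw [vec_cons, vec_cons, hop, ih]
  have hfil : ∀ (d : ℤ), ∀ x ∈ T.fil d, f x ∈ S.fil d := by
    intro d x hx
    induction hx using Submodule.span_induction with
    | zero => simp
    | add x y _ _ hx hy => rw [map_add]; exact add_mem hx hy
    | smul a x _ hx => rw [map_smul]; exact Submodule.smul_mem _ _ hx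
    | mem x hx =>
      obtain ⟨l, hl, rfl⟩ := hx
      rw [hvec]
      exact S.vec_mem hl
  have hpoly : ∀ P, f (T.ofPoly P) = S.ofPoly P := by
    intro P
    rw [P.as_sum]
    simp only [map_sum, ofPoly_monomial, map_smul, hvec]
  -- The shift to `d - 1` makes the base case the zero space. In the inductive step the coefficients
  -- of the symbol of `x` kill `S.vac`, hence `T.vac`, so `x` lies one step lower.
  induction d with
  | zero =>
    intro x hx _
    rw [T.fil_of_neg (by simp)] at hx
    exact (Submodule.mem_bot A).1 hx
  | succ d ih =>
    intro x hx hfx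
    rw [Nat.cast_succ, add_sub_cancel_right] at hx
    obtain ⟨P, hP, hxP⟩ := T.exists_ofPoly hx
    have h1 := hfil _ _ hxP
    rw [map_sub, hfx, zero_sub, neg_mem_iff, hpoly] at h1
    have h2 := T.ofPoly_mem_of_coeff hP fun m => hinj _ (S.coeff_smul_vac hS hP h1 m)
    exact ih x (by simpa using add_mem hxP h2) hfx

end CreationSystem

/-! ### The enveloping algebra and its commutative subalgebra `WZ`. -/

/-- The elements satisfying `P` form a subalgebra containing the image of `ι`; by the universal
property the identity factors through it. -/
lemma universalEnveloping_induction {R g : Type*} [CommRing R] [LieRing g] [LieAlgebra R g]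
    {P : UniversalEnvelopingAlgebra R g → Prop}
    (halg : ∀ r, P (algebraMap R _ r)) (hι : ∀ x, P (UniversalEnvelopingAlgebra.ι R x))
    (hadd : ∀ a b, P a → P b → P (a + b)) (hmul : ∀ a b, P a → P b → P (a * b))
    (u : UniversalEnvelopingAlgebra R g) : P u := by
  let S : Subalgebra R (UniversalEnvelopingAlgebra R g) :=
    { carrier := {u | P u}
      mul_mem' := fun {a b} => hmul a b
      add_mem' := fun {a b} => hadd a b
      algebraMap_mem' := halg }
  let f : g →ₗ⁅R⁆ S :=
    { toFun := fun x => ⟨UniversalEnvelopingAlgebra.ι R x, hι x⟩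
      map_add' := fun x y => Subtype.ext (map_add _ x y)
      map_smul' := fun r x => Subtype.ext (map_smul _ r x)
      map_lie' := fun {x y} => Subtype.ext
        ((UniversalEnvelopingAlgebra.ι R).map_lie x y) }
  have h : S.val.comp (UniversalEnvelopingAlgebra.lift R f) = AlgHom.id R _ := by
    apply UniversalEnvelopingAlgebra.hom_ext
    ext x
    simp [f]
  have h' := congrArg (fun F => F u) h
  simp only [AlgHom.comp_apply, AlgHom.id_apply] at h'
  rw [← h']
  exact (UniversalEnvelopingAlgebra.lift R f u).2

/-- The image of an element of `𝒲` in `𝒰(𝒲)`. -/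
abbrev toU (x : Alg) : U := UniversalEnvelopingAlgebra.ι ℂ x

lemma toU_commutator (x y : Alg) : toU x * toU y - toU y * toU x = toU ⁅x, y⁆ := by
  rw [toU, toU, toU, LieHom.map_lie, LieRing.of_associative_ring_bracket]

lemma toU_comm_of_lie_eq_zero {x y : Alg} (h : ⁅x, y⁆ = 0) : toU x * toU y = toU y * toU x := by
  rw [← sub_eq_zero, toU_commutator, h, toU, map_zero]

lemma lie_L_L (n m : ℤ) : ⁅L n, L m⁆ = ((m : ℂ) - n) • L (m + n) + cocycle n m • z := lie_gen _ _

lemma lie_L_W (n m : ℤ) : ⁅L n, W m⁆ = ((m : ℂ) - n) • W (m + n) + cocycle n m • z := lie_gen _ _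

lemma lie_W_W (n m : ℤ) : ⁅W n, W m⁆ = 0 := lie_gen _ _

lemma lie_z (x : Alg) : ⁅z, x⁆ = 0 := by
  induction x using alg_induction with
  | h0 => simp
  | hadd x y hx hy => rw [lie_add, hx, hy, add_zero]
  | hsmul c x hx => rw [lie_smul, hx, smul_zero]
  | hgen a => rw [lie_gen]; rfl

/-- The generators of the commutative subalgebra of `𝒰(𝒲)` generated by the `W_n` and `z`. -/
def wzGen : Set U := insert (toU z) (Set.range fun n => toU (W n))

/-- The commutative subalgebra of `𝒰(𝒲)` generated by the `W_n` and `z`. -/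
abbrev WZ : Subalgebra ℂ U := Algebra.adjoin ℂ wzGen

instance : IsMulCommutative WZ := by
  refine Algebra.isMulCommutative_adjoin ℂ ?_
  rintro _ (rfl | ⟨n, rfl⟩) _ (rfl | ⟨m, rfl⟩)
  · rfl
  · exact toU_comm_of_lie_eq_zero (lie_z _)
  · exact (toU_comm_of_lie_eq_zero (lie_z _)).symm
  · exact toU_comm_of_lie_eq_zero (lie_W_W _ _)

open scoped IsMulCommutative in
instance : CommRing WZ := inferInstance

/-- `W_n` as an element of the commutative subalgebra. -/
def Wel (n : ℤ) : WZ := ⟨toU (W n), Algebra.subset_adjoin (Or.inr ⟨n, rfl⟩)⟩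

/-- `z` as an element of the commutative subalgebra. -/
def zel : WZ := ⟨toU z, Algebra.subset_adjoin (Or.inl rfl)⟩

lemma wz_induction {P : WZ → Prop} (hz : P zel) (hW : ∀ n, P (Wel n))
    (halg : ∀ c, P (algebraMap ℂ WZ c)) (hadd : ∀ a b, P a → P b → P (a + b))
    (hmul : ∀ a b, P a → P b → P (a * b)) (a : WZ) : P a := by
  obtain ⟨a, ha⟩ := a
  induction ha using Algebra.adjoin_induction with
  | mem x hx =>
    rcases hx with rfl | ⟨n, rfl⟩
    · exact hz
    · exact hW n
  | algebraMap c => exact halg c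
  | add x y hx hy hPx hPy => exact hadd ⟨x, hx⟩ ⟨y, hy⟩ hPx hPy
  | mul x y hx hy hPx hPy => exact hmul ⟨x, hx⟩ ⟨y, hy⟩ hPx hPy

lemma commutator_L_W (n m : ℤ) : toU (L n) * toU (W m) - toU (W m) * toU (L n) =
    ((((m : ℂ) - n) • Wel (m + n) + cocycle n m • zel : WZ) : U) := by
  rw [toU_commutator, lie_L_W, toU, map_add, map_smul, map_smul]
  rfl

lemma commutator_L_mem (n : ℤ) (a : WZ) : toU (L n) * a - a * toU (L n) ∈ WZ := by
  induction a using wz_induction with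
  | hz =>
    rw [zel, ← toU_comm_of_lie_eq_zero (lie_z (L n)), sub_self]
    exact zero_mem _
  | hW m =>
    rw [Wel, commutator_L_W]
    exact SetLike.coe_mem _
  | halg c =>
    rw [Subalgebra.coe_algebraMap, Algebra.commutes, sub_self]
    exact zero_mem _
  | hadd a b ha hb =>
    have h := add_mem ha hb
    convert h using 1
    push_cast
    noncomm_ring
  | hmul a b ha hb =>
    have h := add_mem (mul_mem ha b.2) (mul_mem a.2 hb)
    convert h using 1
    push_cast
    noncomm_ring

/-- The derivation `[L_n, ·]` of the commutative subalgebra generated by the `W_n` and `z`. -/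
def adL (n : ℤ) : Derivation ℂ WZ WZ where
  toFun a := ⟨toU (L n) * a - a * toU (L n), commutator_L_mem n a⟩
  map_add' a b := Subtype.ext (by push_cast; noncomm_ring)
  map_smul' c a := Subtype.ext (by simp [smul_sub])
  map_one_eq_zero' := Subtype.ext (by simp)
  leibniz' a b := by
    rw [smul_eq_mul, smul_eq_mul, mul_comm b]
    exact Subtype.ext (by simp; noncomm_ring)

lemma coe_adL (n : ℤ) (a : WZ) : (adL n a : U) = toU (L n) * a - a * toU (L n) := rfl

lemma adL_W (n m : ℤ) : adL n (Wel m) = ((m : ℂ) - n) • Wel (m + n) + cocycle n m • zel :=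
  Subtype.ext (commutator_L_W n m)

lemma adL_z (n : ℤ) : adL n zel = 0 := by
  apply Subtype.ext
  rw [coe_adL, zel, ← toU_comm_of_lie_eq_zero (lie_z (L n)), sub_self]
  rfl

/-! ### Characters of `𝒲₊` and Whittaker vectors. -/

lemma character_lie (φ : Character) (x y : Plus) : φ ⁅x, y⁆ = 0 := by
  rw [LieHom.map_lie, LieRing.of_associative_ring_bracket, mul_comm, sub_self]

lemma cocycle_of_ne {n m : ℤ} (h : m + n ≠ 0) : cocycle n m = 0 := if_neg h

lemma lie_LPlus_one_LPlus (n : ℕ+) : ⁅LPlus 1, LPlus n⁆ = ((n : ℂ) - 1) • LPlus (n + 1) := by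
  apply Subtype.ext
  have h : ⁅L 1, L (n : ℤ)⁆ = _ := lie_L_L 1 n
  rw [cocycle_of_ne (by positivity), zero_smul, add_zero] at h
  exact h.trans (by simp [LPlus])

lemma lie_LPlus_one_WPlus (n : ℕ+) : ⁅LPlus 1, WPlus n⁆ = ((n : ℂ) - 1) • WPlus (n + 1) := by
  apply Subtype.ext
  have h : ⁅L 1, W (n : ℤ)⁆ = _ := lie_L_W 1 n
  rw [cocycle_of_ne (by positivity), zero_smul, add_zero] at h
  exact h.trans (by simp [WPlus])

lemma sub_one_ne_zero_of_two_le {n : ℕ+} (hn : 2 ≤ n) : (n : ℂ) - 1 ≠ 0 := by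
  rw [sub_ne_zero]
  intro h
  have : (n : ℕ) = 1 := by exact_mod_cast h
  have h2 : (2 : ℕ) ≤ n := by exact_mod_cast hn
  omega

/-- A character kills brackets, and `[L_1, W_n] = (n - 1) W_{n+1}` for `n > 0`. -/
lemma character_W_add_one (φ : Character) {n : ℕ+} (hn : 2 ≤ n) : φ (WPlus (n + 1)) = 0 := by
  have h := character_lie φ (LPlus 1) (WPlus n)
  rw [lie_LPlus_one_WPlus, map_smul, smul_eq_mul] at h
  exact (mul_eq_zero.1 h).resolve_left (sub_one_ne_zero_of_two_le hn)

lemma character_L_add_one (φ : Character) {n : ℕ+} (hn : 2 ≤ n) : φ (LPlus (n + 1)) = 0 := by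
  have h := character_lie φ (LPlus 1) (LPlus n)
  rw [lie_LPlus_one_LPlus, map_smul, smul_eq_mul] at h
  exact (mul_eq_zero.1 h).resolve_left (sub_one_ne_zero_of_two_le hn)

section Module

variable {M : Type*} [AddCommGroup M] [Module U M]

lemma L_smul_wz_smul (n : ℤ) (a : WZ) (v : M) :
    toU (L n) • a • v = a • toU (L n) • v + adL n a • v := by
  simp only [Subalgebra.smul_def, smul_smul, ← add_smul, coe_adL]
  congr 1
  noncomm_ring

variable [Module ℂ M]

/-- The vector `w` is a Whittaker vector of type `φ` for the action of `𝒰(𝒲)`. -/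
structure IsWhittakerFor (φ : Character) (w : M) : Prop where
  L_smul : ∀ n : ℕ+, toU (L n) • w = φ (LPlus n) • w
  W_smul : ∀ n : ℕ+, toU (W n) • w = φ (WPlus n) • w

lemma IsWhittakerFor.W_two_smul {φ : Character} {w : M} (hw : IsWhittakerFor φ w) :
    Wel 2 • w = φ (WPlus 2) • w := hw.W_smul 2

lemma IsWhittakerFor.W_smul_eq_zero {φ : Character} {w : M} (hw : IsWhittakerFor φ w) {n : ℤ}
    (hn : 3 ≤ n) : Wel n • w = 0 := by
  obtain ⟨k, rfl⟩ : ∃ k : ℕ, n = k + 3 := ⟨(n - 3).toNat, by omega⟩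
  have h := hw.W_smul (⟨k + 2, by omega⟩ + 1)
  have h2 : (2 : ℕ+) ≤ (⟨k + 2, by omega⟩ : ℕ+) :=
    (PNat.coe_le_coe _ _).1 (Nat.le_add_left 2 k)
  rw [character_W_add_one φ h2, zero_smul] at h
  rw [← h]
  change toU (W _) • w = _
  congr 3

variable [IsScalarTower ℂ U M]

lemma algebraMap_wz_smul (c : ℂ) (v : M) : algebraMap ℂ WZ c • v = c • v := by
  rw [Subalgebra.smul_def, Subalgebra.coe_algebraMap, algebraMap_smul]

lemma smul_wz_smul (c : ℂ) (a : WZ) (v : M) : (c • a) • v = c • a • v := by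
  rw [Subalgebra.smul_def, Subalgebra.coe_smul, smul_assoc, Subalgebra.smul_def]

lemma L_smul_L_smul (n m : ℤ) (v : M) :
    toU (L n) • toU (L m) • v =
      toU (L m) • toU (L n) • v + ((m : ℂ) - n) • toU (L (m + n)) • v +
        cocycle n m • toU z • v := by
  have h := toU_commutator (L n) (L m)
  rw [lie_L_L, toU, toU, toU, map_add, map_smul, map_smul, sub_eq_iff_eq_add] at h
  rw [smul_smul, h]
  simp only [add_smul, smul_assoc, smul_smul]
  abel

/-- The operators `L_0, L_{-1}, L_{-2}, …` as creation operators over the commutative subalgebra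
generated by the `W_n` and `z`. -/
def creation (w : M) : CreationSystem WZ M where
  op j := DistribSMul.toAddMonoidHom M (toU (L (-(j : ℤ))))
  der j a := adL (-(j : ℤ)) a
  op_smul j a v := L_smul_wz_smul _ a v
  op_comm i j := by
    refine ⟨algebraMap ℂ WZ ((-j : ℤ) - (-i : ℤ)),
      cocycle (-i) (-j) • zel, fun v => ?_⟩
    have h := L_smul_L_smul (-(i : ℤ)) (-(j : ℤ)) v
    rw [algebraMap_wz_smul, smul_wz_smul]
    simp only [DistribSMul.toAddMonoidHom_apply]
    rw [h, show -((i + j : ℕ) : ℤ) = -(j : ℤ) + -(i : ℤ) by push_cast; ring]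
    rfl
  vac := w

/-- For `j ≤ k` one has `[L_{-j}, W_{k+2}] = (k + 2 + j) W_{k+2-j}`. The index is at least `3` if `j
< k`, and equals `2` if `j = k`; the shift by `2` is chosen for this. -/
lemma IsWhittakerFor.isLowering {φ : Character} {w : M} (hw : IsWhittakerFor φ w) (k : ℕ) :
    (creation w).IsLowering k (Wel (k + 2) - algebraMap ℂ WZ (φ (WPlus ⟨k + 2, by omega⟩)))
      (algebraMap ℂ WZ (-(2 * k + 2) * φ (WPlus 2))) where
  smul_vac := by
    change _ • w = 0
    rw [sub_smul, algebraMap_wz_smul, sub_eq_zero]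
    exact hw.W_smul ⟨k + 2, by omega⟩
  der_lt j hj := by
    change adL _ _ • w = 0
    rw [map_sub, Derivation.map_algebraMap, sub_zero, adL_W, cocycle_of_ne (by omega), zero_smul,
      add_zero, smul_wz_smul, hw.W_smul_eq_zero (by omega), smul_zero]
  der_self := by
    change (adL _ _ + _) • w = 0
    rw [map_sub, Derivation.map_algebraMap, sub_zero, adL_W, cocycle_of_ne (by omega), zero_smul,
      add_zero, add_smul, smul_wz_smul, algebraMap_wz_smul,
      show (k : ℤ) + 2 + -(k : ℤ) = 2 by ring, hw.W_two_smul, smul_smul, ← add_smul]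
    convert zero_smul ℂ w
    push_cast
    ring

end Module

/-! ### The annihilator of a Whittaker vector in `WZ`. -/

/-- The homomorphism from polynomials in `z, W_0, W_{-1}, …` to `𝒰(𝒲)`. -/
def wzPoly : MvPolynomial ℕ ℂ[X] →+* WZ :=
  MvPolynomial.eval₂Hom (aeval zel : ℂ[X] →ₐ[ℂ] WZ).toRingHom fun j => Wel (-(j : ℤ))

lemma wzPoly_C (q : ℂ[X]) : wzPoly (MvPolynomial.C q) = aeval zel q :=
  MvPolynomial.eval₂Hom_C _ _ _

lemma wzPoly_X (j : ℕ) : wzPoly (MvPolynomial.X j) = Wel (-(j : ℤ)) :=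
  MvPolynomial.eval₂Hom_X' _ _ _

lemma coe_aeval_zel (q : ℂ[X]) : ((aeval zel q : WZ) : U) = polyZ q :=
  (aeval_algHom_apply WZ.val zel q).symm

lemma adL_aeval_zel (n : ℤ) (q : ℂ[X]) : adL n (aeval zel q) = 0 := by
  rw [Derivation.map_aeval, adL_z, smul_zero]

section Module

variable {M : Type*} [AddCommGroup M] [Module ℂ M] [Module U M] [IsScalarTower ℂ U M]

/-- `L_n` acts on `w` by a scalar, so both terms of the commutator of `L_n` with `a` kill `w`. -/
lemma IsWhittakerFor.adL_smul {φ : Character} {w : M} (hw : IsWhittakerFor φ w) {a : WZ}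
    (ha : a • w = 0) (n : ℕ+) : adL n a • w = 0 := by
  have h := L_smul_wz_smul n a w
  rw [ha, smul_zero, hw.L_smul, Subalgebra.smul_def, smul_comm, ← Subalgebra.smul_def, ha,
    smul_zero, zero_add] at h
  exact h.symm

/-- Both terms obey the Leibniz rule in `Q`, so generators suffice. There `[L_{k+2}, W_{-j}] = -(j +
k + 2) W_{k+2-j}`, which kills `w` for `j < k` and gives `-(2k+2) φ(W_2) w` for `j = k`. -/
lemma IsWhittakerFor.adL_wzPoly {φ : Character} {w : M} (hw : IsWhittakerFor φ w) (k : ℕ)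
    {Q : MvPolynomial ℕ ℂ[X]} (hQ : ∀ m ∈ Q.support, ∀ j ∈ m.support, j ≤ k) :
    (adL (k + 2) (wzPoly Q) - algebraMap ℂ WZ (-(2 * k + 2) * φ (WPlus 2)) *
      wzPoly (MvPolynomial.pderiv k Q)) • w = 0 := by
  have hmem : Q ∈ MvPolynomial.supported ℂ[X] {j | j ≤ k} := by
    rw [MvPolynomial.mem_supported]
    intro j hj
    obtain ⟨m, hm, hj⟩ := (MvPolynomial.mem_vars_iff_mem_support j).1 hj
    exact hQ m hm j hj
  clear hQ
  induction hmem using Algebra.adjoin_induction with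
  | mem x hx =>
    obtain ⟨j, hj, rfl⟩ := hx
    have hj : j ≤ k := hj
    rw [wzPoly_X, adL_W, cocycle_of_ne (by omega), zero_smul, add_zero, sub_smul, smul_wz_smul]
    rcases hj.lt_or_eq with hj | rfl
    · rw [hw.W_smul_eq_zero (by omega), MvPolynomial.pderiv_X_of_ne hj.ne, map_zero, mul_zero,
        zero_smul, smul_zero, sub_zero]
    · rw [MvPolynomial.pderiv_X_self, map_one, mul_one, algebraMap_wz_smul,
        show -(j : ℤ) + (j + 2) = 2 by ring, hw.W_two_smul, smul_smul, ← sub_smul]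
      convert zero_smul ℂ w
      push_cast
      ring
  | algebraMap q =>
    rw [MvPolynomial.algebraMap_eq, wzPoly_C, adL_aeval_zel, MvPolynomial.pderiv_C, map_zero,
      mul_zero, sub_zero, zero_smul]
  | add P Q _ _ hP hQ =>
    have h := congrArg₂ (· + ·) hP hQ
    simp only [← add_smul, add_zero] at h
    rw [← h]
    congr 1
    simp only [map_add]
    ring
  | mul P Q _ _ hP hQ =>
    have h := congrArg₂ (· + ·) (congrArg (wzPoly Q • ·) hP) (congrArg (wzPoly P • ·) hQ)
    simp only [smul_smul, ← add_smul, smul_zero, add_zero] at h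
    rw [← h]
    congr 1
    simp only [map_mul, map_add, Derivation.leibniz, smul_eq_mul]
    ring

/-- A relation between the vectors `W_{-μ} w` over the polynomials in `z` has all its coefficients in
the annihilator of `w`. -/
lemma IsWhittakerFor.coeff_smul_eq_zero {φ : Character} {w : M} (hw : IsWhittakerFor φ w)
    (hφ : φ (WPlus 2) ≠ 0) {Q : MvPolynomial ℕ ℂ[X]} (hQ : wzPoly Q • w = 0) (m : ℕ →₀ ℕ) :
    (aeval zel (Q.coeff m) : WZ) • w = 0 := by
  let I : Ideal WZ := Ideal.torsionOf WZ M w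
  have hI : ∀ a, a ∈ I ↔ a • w = 0 := Ideal.mem_torsionOf_iff w
  let J : Ideal ℂ[X] := I.comap (aeval zel : ℂ[X] →ₐ[ℂ] WZ)
  let K : Ideal (MvPolynomial ℕ ℂ[X]) := I.comap wzPoly
  suffices h : Q.coeff m ∈ J from (hI _).1 h
  refine coeff_mem_of_pderiv_stable J K.toAddSubgroup ?_ ?_ ?_ (P := Q) ((hI _).2 hQ) m
  · intro q hq
    have h : wzPoly (MvPolynomial.C q) ∈ I := hq
    rwa [wzPoly_C] at h
  · intro q hq m
    have hC : MvPolynomial.C q ∈ K := by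
      change wzPoly (MvPolynomial.C q) ∈ I
      rw [wzPoly_C]
      exact hq
    have h := K.mul_mem_left (MvPolynomial.monomial m 1) hC
    rwa [mul_comm, MvPolynomial.C_mul_monomial, mul_one] at h
  · intro k P hP hk
    have h1 := hw.adL_wzPoly k hk
    have h2 : adL ((⟨k + 2, by omega⟩ : ℕ+) : ℕ) (wzPoly P) • w = 0 := hw.adL_smul ((hI _).1 hP) _
    have h2 : adL (k + 2) (wzPoly P) • w = 0 := h2
    rw [sub_smul, h2, zero_sub, neg_eq_zero, mul_smul, algebraMap_wz_smul] at h1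
    have hne : -(2 * (k : ℂ) + 2) * φ (WPlus 2) ≠ 0 := by
      refine mul_ne_zero (neg_ne_zero.2 ?_) hφ
      exact_mod_cast (2 * k + 1).succ_ne_zero
    have h3 := congrArg ((-(2 * (k : ℂ) + 2) * φ (WPlus 2))⁻¹ • ·) h1
    simp only [smul_smul, inv_mul_cancel₀ hne, one_smul, smul_zero] at h3
    exact (hI _).2 h3

lemma IsWhittakerFor.exists_wzPoly_smul {φ : Character} {w : M} (hw : IsWhittakerFor φ w) (a : WZ) :
    ∃ Q, a • w = wzPoly Q • w := by
  induction a using wz_induction with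
  | hz => exact ⟨MvPolynomial.C X, by rw [wzPoly_C, aeval_X]⟩
  | hW n =>
    rcases le_or_gt n 0 with hn | hn
    · refine ⟨MvPolynomial.X (-n).toNat, ?_⟩
      rw [wzPoly_X, show -((-n).toNat : ℤ) = n by omega]
    · obtain ⟨k, rfl⟩ : ∃ k : ℕ+, n = (k : ℕ) := ⟨⟨n.toNat, by omega⟩, by simp; omega⟩
      refine ⟨MvPolynomial.C (C (φ (WPlus k))), ?_⟩
      rw [wzPoly_C, aeval_C, algebraMap_wz_smul]
      exact hw.W_smul k
  | halg c => exact ⟨MvPolynomial.C (C c), by rw [wzPoly_C, aeval_C]⟩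
  | hadd a b ha hb =>
    obtain ⟨P, hP⟩ := ha
    obtain ⟨Q, hQ⟩ := hb
    exact ⟨P + Q, by rw [map_add, add_smul, add_smul, hP, hQ]⟩
  | hmul a b ha hb =>
    obtain ⟨P, hP⟩ := ha
    obtain ⟨Q, hQ⟩ := hb
    exact ⟨P * Q, by rw [map_mul, mul_smul, mul_smul, hQ, smul_comm a, hP, smul_comm]⟩

/-! ### Exhaustion by the filtration, and injectivity. -/

lemma IsWhittakerFor.L_smul_mem_fil {φ : Character} {w : M} (hw : IsWhittakerFor φ w) (n : ℤ)
    {d : ℤ} {v : M} (hv : v ∈ (creation w).fil d) : toU (L n) • v ∈ (creation w).fil (d + 1) := by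
  -- The index `n` must vary in the induction, since moving `L_n` past `L_{-j}` creates `L_{n-j}`.
  have hvec : ∀ (l : List ℕ) (n : ℤ),
      toU (L n) • (creation w).vec l ∈ (creation w).fil ((l.length : ℤ) + 1) := by
    intro l
    induction l with
    | nil =>
      intro n
      rcases le_or_gt n 0 with hn | hn
      · obtain ⟨j, rfl⟩ : ∃ j : ℕ, n = -(j : ℤ) := ⟨(-n).toNat, by omega⟩
        exact (creation w).vec_mem (l := [j]) (by simp)
      · obtain ⟨k, rfl⟩ : ∃ k : ℕ+, n = (k : ℕ) := ⟨⟨n.toNat, by omega⟩, by simp; omega⟩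
        have h := hw.L_smul k
        change toU (L k) • w ∈ _
        rw [h, ← algebraMap_wz_smul]
        exact Submodule.smul_mem _ _ ((creation w).vec_mem (l := []) (by simp))
    | cons j l ih =>
      intro n
      change toU (L n) • toU (L (-(j : ℤ))) • (creation w).vec l ∈ _
      rw [L_smul_L_smul]
      refine add_mem (add_mem ?_ ?_) ?_
      · have h := (creation w).op_mem (ih n) j
        rwa [List.length_cons, Nat.cast_succ]
      · rw [← algebraMap_wz_smul]
        exact Submodule.smul_mem _ _ ((creation w).fil_mono (by simp) (ih _))
      · rw [← algebraMap_wz_smul]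
        refine Submodule.smul_mem _ _ ?_
        exact Submodule.smul_mem _ zel ((creation w).vec_mem (by simp; omega))
  induction hv using Submodule.span_induction with
  | zero => rw [smul_zero]; exact zero_mem _
  | add x y _ _ hx hy => rw [smul_add]; exact add_mem hx hy
  | smul a x hx h =>
    rw [L_smul_wz_smul]
    exact add_mem (Submodule.smul_mem _ _ h)
      (Submodule.smul_mem _ _ ((creation w).fil_mono (by omega) hx))
  | mem x hx =>
    obtain ⟨l, hl, rfl⟩ := hx
    exact (creation w).fil_mono (by omega) (hvec l n)

lemma IsWhittakerFor.exists_smul_mem_fil {φ : Character} {w : M} (hw : IsWhittakerFor φ w) (u : U) :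
    ∃ d : ℕ, u • w ∈ (creation w).fil d := by
  suffices h : ∀ (v : M) (d : ℕ), v ∈ (creation w).fil d → ∃ e : ℕ, u • v ∈ (creation w).fil e from
    h w 0 ((creation w).vec_mem (l := []) (by simp))
  have hadd : ∀ a b : U, (∀ (v : M) (d : ℕ), v ∈ (creation w).fil d →
      ∃ e : ℕ, a • v ∈ (creation w).fil e) → (∀ (v : M) (d : ℕ), v ∈ (creation w).fil d →
      ∃ e : ℕ, b • v ∈ (creation w).fil e) → ∀ (v : M) (d : ℕ), v ∈ (creation w).fil d →
      ∃ e : ℕ, (a + b) • v ∈ (creation w).fil e := by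
    intro a b ha hb v d hv
    obtain ⟨e, he⟩ := ha v d hv
    obtain ⟨e', he'⟩ := hb v d hv
    refine ⟨max e e', ?_⟩
    rw [add_smul]
    exact add_mem ((creation w).fil_mono (by simp) he) ((creation w).fil_mono (by simp) he')
  induction u using universalEnveloping_induction with
  | halg c =>
    intro v d hv
    rw [algebraMap_smul, ← algebraMap_wz_smul]
    exact ⟨d, Submodule.smul_mem _ _ hv⟩
  | hadd a b ha hb => exact hadd a b ha hb
  | hmul a b ha hb =>
    intro v d hv
    obtain ⟨e, he⟩ := hb v d hv
    rw [mul_smul]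
    exact ha _ e he
  | hι x =>
    induction x using alg_induction with
    | h0 => exact fun v d _ => ⟨d, by rw [map_zero, zero_smul]; exact zero_mem _⟩
    | hadd x y hx hy => rw [map_add]; exact hadd _ _ hx hy
    | hsmul c x hx =>
      intro v d hv
      obtain ⟨e, he⟩ := hx v d hv
      rw [map_smul, smul_assoc, ← algebraMap_wz_smul]
      exact ⟨e, Submodule.smul_mem _ _ he⟩
    | hgen a =>
      intro v d hv
      rcases a with n | n | _
      · exact ⟨d + 1, by exact_mod_cast hw.L_smul_mem_fil n hv⟩
      · exact ⟨d, Submodule.smul_mem _ (Wel n) hv⟩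
      · exact ⟨d, Submodule.smul_mem _ zel hv⟩

/-- A homomorphism between modules with cyclic Whittaker vectors is injective if it is injective on
the multiples of the Whittaker vector by polynomials in `z`. -/
theorem eq_zero_of_map_eq_zero {M' : Type*} [AddCommGroup M'] [Module ℂ M'] [Module U M']
    [IsScalarTower ℂ U M'] {φ : Character} (hφ : φ (WPlus 2) ≠ 0) {w : M} (hw : IsWhittakerFor φ w)
    {w' : M'} (hw' : IsWhittakerFor φ w') (f : M →ₗ[U] M') (hf : f w = w')
    (hz : ∀ q, polyZ q • w' = 0 → polyZ q • w = 0) (u : U) (hu : f (u • w) = 0) : u • w = 0 := by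
  let g : M →ₗ[WZ] M' :=
    { toFun := f
      map_add' := f.map_add
      map_smul' := fun a x => f.map_smul (a : U) x }
  obtain ⟨d, hd⟩ := hw.exists_smul_mem_fil u
  refine (creation w').eq_zero_of_map_eq_zero (creation w) (fun k => ⟨_, _, ?_, hw'.isLowering k⟩) g
    (fun j x => f.map_smul _ x) hf ?_ (d + 1) _ (by simpa using hd) hu
  · refine mul_ne_zero (neg_ne_zero.2 ?_) hφ
    exact_mod_cast (2 * k + 1).succ_ne_zero
  · intro a ha
    change a • w = 0
    have ha : a • w' = 0 := ha
    -- On `w` the element `a` acts as a polynomial in the `W_{-j}` over `ℂ[z]`. Its coefficients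
    -- kill `w'`, hence `w` by `hz`.
    obtain ⟨Q, hQ⟩ := hw.exists_wzPoly_smul a
    have hQ' : wzPoly Q • w' = 0 := by
      rw [← ha, ← hf]
      exact ((g.map_smul _ w).symm.trans (congrArg g hQ.symm)).trans (g.map_smul _ w)
    have hco := hw'.coeff_smul_eq_zero hφ hQ'
    rw [hQ, Q.as_sum, map_sum, Finset.sum_smul]
    refine Finset.sum_eq_zero fun m _ => ?_
    have h0 : (aeval zel (Q.coeff m) : WZ) • w = 0 := by
      have h := hz (Q.coeff m)
      rw [← coe_aeval_zel] at h
      exact h (hco m)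
    rw [← mul_one (Q.coeff m), ← MvPolynomial.C_mul_monomial, map_mul, wzPoly_C, mul_comm, mul_smul,
      h0, smul_zero]

end Module

/-! ### Recovering the Whittaker property from the products `L_λ W_μ`. -/

lemma ext_L_mul_W (φ : Character) (lam mu : PosPartition) : φ.ext (lam.L * mu.W) =
    (lam.parts.map fun n => φ (LPlus n)).prod * (mu.parts.map fun n => φ (WPlus n)).prod := by
  rw [map_mul, PosPartition.L, PosPartition.W, map_list_prod, map_list_prod, List.map_map,
    List.map_map]
  simp only [Character.ext, Function.comp_def, UniversalEnvelopingAlgebra.lift_ι_apply]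

lemma incl_L_mul_W (lam mu : PosPartition) : incl (lam.L * mu.W) =
    (lam.parts.map fun n : ℕ+ => toU (L n)).prod * (mu.parts.map fun n : ℕ+ => toU (W n)).prod := by
  rw [map_mul, PosPartition.L, PosPartition.W, map_list_prod, map_list_prod, List.map_map,
    List.map_map]
  simp only [incl, Function.comp_def, UniversalEnvelopingAlgebra.lift_ι_apply]
  rfl

/-- The partition with a single part. -/
def PosPartition.single (n : ℕ+) : PosPartition := ⟨[n], by simp, by simp⟩

/-- The partition with two equal parts. -/
def PosPartition.pair (n : ℕ+) : PosPartition := ⟨[n, n], by simp, by simp⟩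

lemma two_le_of_ne_one {n : ℕ+} (hn : n ≠ 1) : 2 ≤ n := by
  have h1 : (n : ℕ) ≠ 1 := fun h => hn (PNat.eq h)
  have h0 := n.pos
  exact (PNat.coe_le_coe 2 n).1 (show 2 ≤ (n : ℕ) by omega)

section Module

variable {M : Type*} [AddCommGroup M] [Module ℂ M] [Module U M] [IsScalarTower ℂ U M]

/-- If the products `L_λ W_μ` act on `w` by `φ`, then `w` is a Whittaker vector. -/
lemma isWhittakerFor_of_partitions {φ : Character} (hφ : φ.NonSingular) {w : M}
    (h : ∀ lam mu : PosPartition,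
      incl (lam.L * mu.W) • w = φ.ext (lam.L * mu.W) • w) : IsWhittakerFor φ w := by
  have hLW : ∀ i j : ℕ+, toU (L i) • toU (W j) • w = (φ (LPlus i) * φ (WPlus j)) • w := by
    intro i j
    have := h (.single i) (.single j)
    rw [incl_L_mul_W, ext_L_mul_W] at this
    simpa only [PosPartition.single, List.map_cons, List.map_nil, List.prod_cons, List.prod_nil,
      mul_one, mul_smul] using this
  have hLLW : ∀ i j : ℕ+, toU (L i) • toU (L i) • toU (W j) • w =
      (φ (LPlus i) * φ (LPlus i) * φ (WPlus j)) • w := by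
    intro i j
    have := h (.pair i) (.single j)
    rw [incl_L_mul_W, ext_L_mul_W] at this
    simpa only [PosPartition.single, PosPartition.pair, List.map_cons, List.map_nil, List.prod_cons,
      List.prod_nil, mul_one, mul_smul] using this
  have hLWW : ∀ i j : ℕ+, toU (L i) • toU (W j) • toU (W j) • w =
      (φ (LPlus i) * (φ (WPlus j) * φ (WPlus j))) • w := by
    intro i j
    have := h (.single i) (.pair j)
    rw [incl_L_mul_W, ext_L_mul_W] at this
    simpa only [PosPartition.single, PosPartition.pair, List.map_cons, List.map_nil, List.prod_cons,
      List.prod_nil, mul_one, mul_smul] using this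
  -- As both partitions are nonempty, `L_i` alone is not among the relations. Applying `L_i` to the
  -- relation for `L_i W_i` and comparing with the one for `L_i L_i W_i` allows `φ(L_i) φ(W_i)` to
  -- be cancelled.
  have hL : ∀ i : ℕ+, φ (LPlus i) * φ (WPlus i) ≠ 0 → toU (L i) • w = φ (LPlus i) • w := by
    intro i hi
    have h1 := hLLW i i
    rw [hLW, smul_comm] at h1
    refine smul_right_injective M hi (h1.trans ?_)
    simp only [smul_smul]
    congr 1
    ring
  have hW : ∀ i : ℕ+, φ (LPlus i) * φ (WPlus i) ≠ 0 → toU (W i) • w = φ (WPlus i) • w := by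
    intro i hi
    -- Equal positive indices commute, so `L_i W_i W_i w` is `W_i` applied to `L_i W_i w`.
    have hcomm : toU (L i) * toU (W i) = toU (W i) * toU (L i) :=
      toU_comm_of_lie_eq_zero (by
        rw [lie_L_W, sub_self, zero_smul, zero_add,
          cocycle_of_ne (by have := i.pos; omega), zero_smul])
    have h1 := hLWW i i
    rw [smul_smul, hcomm, mul_smul, hLW, smul_comm] at h1
    refine smul_right_injective M hi (h1.trans ?_)
    simp only [smul_smul, mul_assoc]
  -- Operators acting on `w` by scalars have a commutator that kills `w`. Bracketing with `L_1` thus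
  -- reaches every index from `3` on, starting from index `2`.
  have hsucc : ∀ n : ℕ+, 2 ≤ n → ∀ X : ℤ → Alg,
      ⁅L 1, X n⁆ = ((n : ℂ) - 1) • X (n + 1) → ∀ c : ℂ, toU (X n) • w = c • w →
      toU (X (n + 1)) • w = 0 := by
    intro n hn X hX c hc
    have h1 := congrArg (· • w) (toU_commutator (L 1) (X n))
    have hL1 : toU (L 1) • w = φ (LPlus 1) • w := hL 1 hφ.1
    simp only [sub_smul, mul_smul] at h1
    rw [hc, hL1, smul_comm, hL1, smul_comm (toU (X n)), hc, smul_comm c, sub_self, hX, toU,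
      map_smul, smul_assoc] at h1
    exact (smul_eq_zero.1 h1.symm).resolve_left (sub_one_ne_zero_of_two_le hn)
  constructor
  · intro n
    induction n using PNat.recOn with
    | one => exact hL 1 hφ.1
    | succ n ih =>
      rcases eq_or_ne n 1 with rfl | hn
      · exact hL 2 hφ.2
      · have hn2 := two_le_of_ne_one hn
        rw [character_L_add_one φ hn2, zero_smul]
        refine hsucc n hn2 L ?_ _ ih
        exact congrArg Subtype.val (lie_LPlus_one_LPlus n)
  · intro n
    induction n using PNat.recOn with
    | one => exact hW 1 hφ.1
    | succ n ih =>
      rcases eq_or_ne n 1 with rfl | hn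
      · exact hW 2 hφ.2
      · have hn2 := two_le_of_ne_one hn
        rw [character_W_add_one φ hn2, zero_smul]
        refine hsucc n hn2 W ?_ _ ih
        exact congrArg Subtype.val (lie_LPlus_one_WPlus n)

end Module

end W22

end

/-! ### Comparison of `U ⧸ J` with `V`. -/

theorem corollary5p1p3 {V : Type*} [AddCommGroup V] [Module ℂ V] [LieRingModule W22.Alg V]
    [LieModule ℂ W22.Alg V] (φ : W22.Character) (w : V) (hw : W22.IsCyclicWhittakerVector φ w)
    (p : ℂ[X]) (hp : p.Monic) (hann : W22.annS w = Ideal.span {p}) :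
    W22.annU w =
      Ideal.span {W22.polyZ p} ⊔
        ⨆ (lam : W22.PosPartition) (mu : W22.PosPartition),
          Ideal.span {W22.incl (lam.L * mu.W) -
            algebraMap ℂ W22.U (φ.ext (lam.L * mu.W))} := by
  open W22 in
  let _ : Module U V := Module.compHom V (act V).toRingHom
  have hsmul : ∀ (u : U) (v : V), u • v = act V u v := fun _ _ => rfl
  have : IsScalarTower ℂ U V := ⟨fun c u v => by rw [hsmul, map_smul]; rfl⟩
  have hplus : ∀ x : Plus, toU x • w = φ x • w := fun x => by
    rw [hsmul, act, UniversalEnvelopingAlgebra.lift_ι_apply]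
    exact hw.isWhittaker x
  have hV : IsWhittakerFor φ w := ⟨fun n => hplus (LPlus n), fun n => hplus (WPlus n)⟩
  have hext : ∀ x : UPlus, incl x • w = φ.ext x • w := by
    intro x
    induction x using universalEnveloping_induction with
    | halg c => rw [AlgHom.commutes, AlgHom.commutes, algebraMap_smul]; rfl
    | hι x =>
      rw [incl, Character.ext, UniversalEnvelopingAlgebra.lift_ι_apply,
        UniversalEnvelopingAlgebra.lift_ι_apply]
      exact hplus x
    | hadd a b ha hb => rw [map_add, map_add, add_smul, add_smul, ha, hb]
    | hmul a b ha hb => rw [map_mul, map_mul, mul_smul, hb, smul_comm, ha, smul_smul, mul_comm]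
  set J : Ideal U := Ideal.span {polyZ p} ⊔ ⨆ (lam : PosPartition) (mu : PosPartition),
    Ideal.span {incl (lam.L * mu.W) - algebraMap ℂ U (φ.ext (lam.L * mu.W))} with hJ
  have hpJ : polyZ p ∈ J := Submodule.mem_sup_left (Ideal.subset_span rfl)
  have hgenJ : ∀ lam mu : PosPartition,
      incl (lam.L * mu.W) - algebraMap ℂ U (φ.ext (lam.L * mu.W)) ∈ J := fun lam mu =>
    Submodule.mem_sup_right (Submodule.mem_iSup_of_mem lam (Submodule.mem_iSup_of_mem mu
      (Ideal.subset_span rfl)))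
  have hle : J ≤ annU w := by
    refine sup_le ?_ (iSup_le fun lam => iSup_le fun mu => ?_)
    · rw [Ideal.span_singleton_le_iff_mem]
      have : p ∈ annS w := hann ▸ Ideal.mem_span_singleton_self p
      exact this
    · rw [Ideal.span_singleton_le_iff_mem]
      change (incl (lam.L * mu.W) - algebraMap ℂ U (φ.ext (lam.L * mu.W))) • w = 0
      rw [sub_smul, hext, algebraMap_smul, sub_self]
  refine le_antisymm (fun u hu => ?_) hle
  let v : U ⧸ J := Submodule.Quotient.mk 1
  have hv : ∀ u : U, u • v = 0 ↔ u ∈ J := fun u => by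
    rw [← Submodule.Quotient.mk_smul, smul_eq_mul, mul_one, Submodule.Quotient.mk_eq_zero]
  have hM : IsWhittakerFor φ v := isWhittakerFor_of_partitions hw.nonSingular fun lam mu => by
    rw [← sub_eq_zero, ← algebraMap_smul U (φ.ext _) v, ← sub_smul, hv]
    exact hgenJ lam mu
  let f : (U ⧸ J) →ₗ[U] V := J.liftQ (LinearMap.toSpanSingleton U V w) fun a ha => hle ha
  have hf : f v = w := (J.liftQ_apply _ 1).trans (one_smul U w)
  -- Only polynomials in `z` remain to be checked: those killing `w` are multiples of `p`, and `p(z)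
  -- ∈ J`.
  refine (hv u).1 (eq_zero_of_map_eq_zero (right_ne_zero_of_mul hw.nonSingular.2) hM hV f hf ?_ u ?_)
  · intro q hq
    have hq : q ∈ annS w := hq
    rw [hann, Ideal.mem_span_singleton'] at hq
    obtain ⟨r, rfl⟩ := hq
    rw [hv, polyZ, map_mul]
    exact J.mul_mem_left _ hpJ
  · rw [map_smul, hf]
    exact hu
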